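/- Let $G$ be an abelian group (written additively, not necessarily finite). For a finite subset $S\subseteq G$ let $\Sigma(S)=\{\sum_{x\in T}x : \emptyset\neq T\subseteq S\}$, and call $S$ zero-sum free if $0\notin\Sigma(S)$. Let $S$ be a zero-sum free subset of $G$ with $|S|=6$. Then $|\Sigma(S)|=19$ if and only if there exist $x_1,x_2,x_3\in G$ such that $S$ has one of the following forms: (i) $S=\{x_1,\ x_2,\ x_3,\ x_1+x_3,\ x_2+x_3,\ x_1+x_2+x_3\}$, where $\operatorname{ord}(x_1)=2$ and $2x_2\in\langle x_1\rangle$; (ii) $S=\{x_1,\ x_2,\ 2x_2,\ 3x_2,\ x_1+x_2,\ x_1+2x_2\}$, where $\operatorname{ord}(x_1)=2$; (iii) $S=\{-2x_1,\ x_1,\ 3x_1,\ 4x_1,\ 5x_1,\ 6x_1\}$, where $\operatorname{ord}(x_1)=20$; (iv) $S=\{-3x_1,\ x_1,\ 4x_1,\ 5x_1,\ 9x_1,\ 12x_1\}$, where $\operatorname{ord}(x_1)=20$; (v) $S=\{x_1,\ x_2,\ x_1+x_2,\ x_1+2x_2,\ 2x_1+x_2,\ 4x_1+4x_2\}$, where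 $2x_1=2x_2$ and $\operatorname{ord}(x_1)=\operatorname{ord}(x_2)=10$. -/

import Mathlib

/-- The finite set `Σ(S)` of all sums of nonempty subsets of a finite subset `S` of an additive
abelian group. -/
def subsetSums {G : Type*} [AddCommGroup G] [DecidableEq G] (S : Finset G) : Finset G :=
  (S.powerset.filter Finset.Nonempty).image fun T => ∑ x ∈ T, x

/-- `S` is zero-sum free if no nonempty subset of `S` has sum zero. -/
def IsZeroSumFree {G : Type*} [AddCommGroup G] [DecidableEq G] (S : Finset G) : Prop :=
  (0 : G) ∉ subsetSums S

/-! Enumerate `S` as `s 0, …, s 5`. Adjoining the empty sum, which by zero-sum freeness is a new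
value, turns `|Σ(S)| = 19` into: the 64 subset sums take exactly 20 values. Two subset sums agree
iff an integer vector with entries in `{-1, 0, 1}` vanishes at `s`, so the problem concerns which
small vectors vanish.

The forward direction is a finite branching proof, checked by kernel evaluation. A state consists of
vectors known to vanish (`Y`) and known not to vanish (`N`); initially `N` expresses zero-sum
freeness and injectivity of `s`. Adding a vanishing vector does not change values, so both sets are
closed up under translation by known relations (entries up to 2 leave room for this). A branch dies
if `Y` meets `N`, or if 21 points with pairwise differences in `N` appear, since these give 21
distinct sums. Otherwise some undecided difference is assumed to vanish or not to vanish. When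
nothing is left to decide, the relations in `Y` must yield one of the five forms. Only `|Σ(S)| ≤ 19`
is used. `search_sound` carries this argument; its inputs are the case where no element is the sum
of two others and the case `s 4 = s 3 + s 2`, the latter subdivided further.

Conversely, each form supplies explicit relations. Their consequences sort the 64 points into at
most 20 classes, while zero-sum freeness makes 20 points pairwise different
(`IsEnumeration.card_of_certificate`). -/

namespace SubsetSumSearch

/-! ### Forcing evaluation in the kernel

The search below is run by kernel reduction. `force` evaluates a number to a literal before it is
passed on; `forceSet` does the same and attaches a checksum, because the kernel hashes a large
literal by its low bits only. -/

/-- `f n`, with `n` evaluated first. -/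
def force {α : Type*} (n : ℕ) (f : ℕ → α) : α :=
  Nat.rec (f 0) (fun m _ => f (Nat.succ m)) n

/-- The number `n`, carrying a second number that is ignored. -/
def tagged (n _h : ℕ) : ℕ := n

/-- `f n`, with `n` evaluated first and tagged by a checksum. -/
def forceSet {α : Type*} (n : ℕ) (f : ℕ → α) : α :=
  -- The modulus is `2 ^ 61 - 1`; being odd, it makes the remainder depend on the high bits as well.
  force (Nat.mod n 2305843009213693951) fun h => force n fun n => f (tagged n h)

/-- `f l`, with the entries of `l` evaluated first. -/
def forceList {α : Type*} (l : List ℕ) : (List ℕ → α) → α :=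
  List.rec (fun f => f []) (fun n _ ih f => force n fun n => ih fun l => f (n :: l)) l

/-! ### Sets of vectors as bit masks

A vector `v` with entries in `[-2, 2]` and `k` coordinates is coded by `∑ (v i + 2) * 5 ^ i`, and a
set of such vectors by the number whose binary digits mark the codes of its members. For `k = 6` the
zero vector has code `7812`. -/

/-- Membership of `p` in the set coded by `A`. -/
def bit (A p : ℕ) : Bool := Nat.beq (Nat.land (Nat.shiftRight A p) 1) 1

/-- The set of the members of a list. -/
def bits (l : List ℕ) : ℕ := l.foldr (fun i a => Nat.lor (Nat.shiftLeft 1 i) a) 0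

/-- Sums of distinct powers `5 ^ i`, `i < k`: the codes of the `0`-`1` vectors, relative to the code
of the zero vector. -/
def points : ℕ → List ℕ
  | 0 => [0]
  | k + 1 => points k ++ (points k).map fun n => Nat.add n (Nat.pow 5 k)

/-- The union of the shifts of `b` by `j * w` over the `j < r` at distance at most `2` from `q`. -/
def layers (b w q r : ℕ) : ℕ :=
  Nat.rec 0 (fun j ih => cond (Nat.ble j (Nat.add q 2)) (cond (Nat.ble q (Nat.add j 2))
    (Nat.lor (Nat.shiftLeft b (Nat.mul j w)) ih) ih) ih) r

/-- The set of the vectors that differ from the one coded by `m` by at most `2` in each of the `k`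
coordinates. -/
def mask (k : ℕ) : ℕ → ℕ :=
  Nat.rec (fun _ => 1) (fun k ih m => force (Nat.pow 5 k) fun w =>
    force (ih (Nat.mod m w)) fun b => force (Nat.div m w) fun q => layers b w q 5) k

/-- The union of `A` and its translates by the vector with relative code `d` and its negative. -/
def translate (A d K : ℕ) : ℕ :=
  Nat.lor (Nat.shiftLeft (Nat.land A K) d) (Nat.lor A (Nat.land (Nat.shiftRight A d) K))

/-- Successive enlargement of a set by translations; the second entries are the masks. -/
def saturate (g : List (ℕ × ℕ)) : ℕ → ℕ :=
  List.rec (fun A => A) (fun r _ ih A => forceSet (translate A r.1 r.2) ih) g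

/-- The points whose difference from the point `p` belongs to `A`. -/
def around (A p : ℕ) : ℕ := Nat.shiftRight A (Nat.sub 7812 p)

/-! ### The search -/

/-- Collect greedily, from the candidates `C` in the list `l`, points with pairwise differences in
`N`, until `f` of them are found; if there are fewer, continue with `k`. -/
def clique (N : ℕ) (k : ℕ → List ℕ → Bool) (l : List ℕ) : ℕ → ℕ → ℕ → List ℕ → Bool :=
  List.rec (fun f _ M Q => cond (Nat.beq f 0) true (k M Q))
    (fun p _ ih f C M Q => cond (Nat.beq f 0) true
      (cond (bit C p)
        (forceSet (Nat.land C (around N p)) fun C =>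
          forceSet (Nat.lor M (Nat.shiftLeft 1 p)) fun M =>
          force (Nat.pred f) fun f => ih f C M (p :: Q))
        (ih f C M Q))) l

/-- The first entry of a list that belongs to `c`. -/
def firstBit (c : ℕ) (l : List ℕ) : ℕ :=
  List.rec 0 (fun q _ ih => cond (bit c q) q ih) l

/-- The distance of two numbers. -/
def dist (p q : ℕ) : ℕ := Nat.add (Nat.sub p q) (Nat.sub q p)

/-- Choose the difference to branch on: one between a member of the clique `Q` (with mask `M`) and a
point of the list `l` that is neither in `Y` nor in `N`, and `0` if there is none. -/
def pick (M Y N : ℕ) (Q l : List ℕ) : ℕ → ℕ :=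
  List.rec (fun d => d)
    (fun p _ ih d => cond (bit M p) (ih d)
      -- `c` holds the clique members not known to differ from `p`. If none of them is known to
      -- equal `p` and `c` has a single bit (`c &&& (c - 1) = 0`), that difference is chosen at
      -- once: its nonvanishing would separate `p` from the whole clique. Otherwise the first
      -- undecided difference is kept.
      (forceSet (Nat.xor M (Nat.land M (around N p))) fun c =>
        cond (Nat.beq (Nat.land c (around Y p)) 0)
          (cond (Nat.beq (Nat.land c (Nat.pred c)) 0) (dist (firstBit c Q) p)
            (ih (cond (Nat.beq d 0) (dist (firstBit c Q) p) d)))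
          (ih d))) l

/-- The vector with relative code `d` and its negative. -/
def pair (d : ℕ) : ℕ :=
  Nat.lor (Nat.shiftLeft 1 (Nat.sub 7812 d)) (Nat.shiftLeft 1 (Nat.add 7812 d))

/-- The search for an assignment in which the vectors in `Y` vanish, those in `N` do not vanish and
fewer than `21` subset sums are distinct. It succeeds if every branch ends in a contradiction or
satisfies `form`. -/
def search (P : ℕ) (L : List ℕ) (form : ℕ → Bool) (f : ℕ) : ℕ → ℕ → List (ℕ × ℕ) → Bool :=
  Nat.rec (fun _ _ _ => false)
    (fun _ ih Y N g => forceSet Y fun Y => forceSet (saturate g N) fun N =>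
      cond (Nat.beq (Nat.land Y N) 0)
        (clique N (fun M Q => force (pick M Y N Q L 0) fun d =>
          cond (Nat.beq d 0) (form Y)
            (cond (Nat.ble d 7812)
              (forceSet (mask 6 (Nat.sub 7812 d)) fun D => forceSet (pair d) fun B =>
              -- `Y` grows only here, so it is saturated only here; `N` is saturated on entry to
              -- each node.
              cond (ih (saturate ((d, D) :: g) (Nat.lor Y B)) N ((d, D) :: g))
                (ih Y (Nat.lor N B) g) false) false)) L 21 P 0 [])
        true) f

/-! ### The final configurations -/

/-- The sum of `5 ^ i` over a list. -/
def weight (l : List ℕ) : ℕ := l.foldr (fun i a => Nat.add (Nat.pow 5 i) a) 0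

/-- The set `Y` contains the relation between the sums over `p` and `q`. -/
def rel (Y : ℕ) (p q : List ℕ) : Bool := bit Y (Nat.sub (Nat.add (weight p) 7812) (weight q))

/-- Some index below `6` satisfies `f`. -/
def anyIndex (f : ℕ → Bool) : Bool := [0, 1, 2, 3, 4, 5].any f

/-- The relations in `Y` imply one of the first two forms of the classification. -/
def formTorsion (Y : ℕ) : Bool :=
  -- These two relations give `2a = 0`, so `a` plays `x₁`. In form (i) `b` is `x₃` and `d` is `x₂`;
  -- in form (ii) `b` is `x₂`.
  anyIndex fun a => anyIndex fun b => anyIndex fun c => rel Y [a, b] [c] && (rel Y [a, c] [b] &&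
    ((anyIndex fun d => anyIndex fun e => rel Y [d, b] [e] &&
      ((rel Y [d, e] [b] || rel Y [d, e] [c]) &&
      anyIndex fun f => rel Y [a, e] [f] && decide [a, d, b, c, e, f].Nodup)) ||
    (anyIndex fun d => rel Y [b, c] [d] && anyIndex fun e => rel Y [a, d] [e] &&
      anyIndex fun f => rel Y [e, b] [f] && decide [a, b, e, f, c, d].Nodup)))

/-- The relations in `Y` imply the third form of the classification. -/
def formCyclic (Y : ℕ) : Bool :=
  -- The letters stand for `-2, 1, 3, 4, 5, 6` times `x₁`; the last relation reads `18 = -2` modulo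
  -- 20.
  anyIndex fun a => anyIndex fun b => anyIndex fun c => rel Y [c, a] [b] &&
    anyIndex fun d => rel Y [c, b] [d] && anyIndex fun e => rel Y [d, b] [e] &&
      (rel Y [e, a] [c] && anyIndex fun f => rel Y [e, b] [f] &&
        (rel Y [c, d, e, f] [a] && decide [a, b, c, d, e, f].Nodup))

/-- The relations in `Y` imply the fourth form of the classification. -/
def formCyclic' (Y : ℕ) : Bool :=
  -- The letters stand for `-3, 1, 4, 5, 9, 12` times `x₁`; `f + e = b` reads `21 = 1` modulo 20.
  anyIndex fun a => anyIndex fun b => anyIndex fun c => rel Y [a, c] [b] &&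
    anyIndex fun d => rel Y [c, b] [d] && anyIndex fun e => rel Y [d, c] [e] &&
      anyIndex fun f => rel Y [f, a] [e] &&
        (rel Y [f, e] [b] && (rel Y [a, b, d, e] [f] && decide [a, b, c, d, e, f].Nodup))

/-- The relations in `Y` imply the fifth form of the classification. -/
def formBicyclic (Y : ℕ) : Bool :=
  anyIndex fun a => anyIndex fun b => anyIndex fun c => rel Y [a, b] [c] &&
    anyIndex fun d => rel Y [b, c] [d] && anyIndex fun e => rel Y [a, c] [e] &&
      (rel Y [a, e] [b, d] && anyIndex fun f => rel Y [c, d, e] [f] &&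
        (rel Y [f, d] [a] && decide [a, b, c, d, e, f].Nodup))

/-- The relations in `Y` imply one of the forms of the classification. -/
def form (Y : ℕ) : Bool := formTorsion Y || (formCyclic Y || (formCyclic' Y || formBicyclic Y))

/-! ### The initial states -/

/-- Vectors that do not vanish on a zero-sum free set of `6` elements. -/
def excluded : List ℕ :=
  ((points 6).filter (· ≠ 0)).flatMap (fun p => [7812 + p, 7812 - p]) ++
    (List.range 6).flatMap fun i => ((List.range 6).filter (· ≠ i)).map fun j => 7812 + 5 ^ i - 5 ^ j

/-- Vectors that express that one element is the sum of two others. -/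
def triples : List ℕ :=
  (List.range 6).flatMap fun i => (List.range 6).flatMap fun j =>
    ((List.range 6).filter fun k => k ≠ i ∧ j < k ∧ j ≠ i).flatMap fun k =>
      [5 ^ i + 7812 - (5 ^ j + 5 ^ k), 5 ^ j + 5 ^ k + 7812 - 5 ^ i]

/-- The search from a given initial state, with relations given by their relative codes. -/
def searchFrom (g : List ℕ) (N : ℕ) : Bool :=
  forceSet (bits (points 6)) fun P => forceSet N fun N =>
    forceList (points 6).reverse fun L => forceList g fun g =>
      -- The 60 bounds the depth of branching; exhausting it returns `false`, so soundness does not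
      -- depend on it.
      search P L form 60 (bits (7812 :: g.flatMap fun d => [7812 - d, 7812 + d])) N
        (g.map fun d => (d, mask 6 (7812 - d)))

/-- The relative codes of the relations on which the search with `x₄ = x₃ + x₂` branches first. -/
def branches : List ℕ :=
  -- Read in base 5 with signed digits: `146 = 5^3 + 5^2 - 5 + 1` codes `s 3 + s 2 + s 0 = s 1`. The
  -- choice of list only divides the computation; the case split is valid for any list.
  [146, 154, 525, 725, 731, 106, 19, 730, 129, 105, 21, 726, 121, 101, 29, 531, 94, 95, 99, 119,
    144, 530, 96, 526, 104]

/-- The part of the search with `x₄ = x₃ + x₂` in which the `i`-th branching relation is the first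
one that holds. -/
def searchBranch (i : ℕ) : Bool :=
  searchFrom (branches.getD i 0 :: [475])
    (bits (excluded ++ (branches.take i).flatMap fun d => [7812 - d, 7812 + d]))

/-- Every member of `C` in the list `l` is reached from at most `f` points by differences in `Y`. -/
def cover (Y : ℕ) (l : List ℕ) : ℕ → ℕ → Bool :=
  List.rec (fun _ C => Nat.beq C 0)
    (fun p _ ih f C => cond (bit C p)
      (cond (Nat.beq f 0) false (forceSet (Nat.xor C (Nat.land C (around Y p))) fun C =>
        force (Nat.pred f) fun f => ih f C))
      (ih f C)) l

/-- Three rounds of saturation. -/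
def saturateThrice (g : List (ℕ × ℕ)) (A : ℕ) : ℕ := saturate g (saturate g (saturate g A))

/-- The relations between the sums over pairs of lists of indices leave exactly `20` subset sums,
the empty one included. -/
def certificate (R : List (List ℕ × List ℕ)) : Bool :=
  forceSet (bits (points 6)) fun P => forceList (points 6).reverse fun L =>
    forceList (R.map fun r => dist (weight r.1) (weight r.2)) fun D =>
      forceSet (saturateThrice (D.map fun d => (d, mask 6 (7812 - d))) (bits excluded)) fun N =>
      forceSet (saturateThrice (D.map fun d => (d, mask 6 (7812 - d))) (bits [7812])) fun Y =>
        clique N (fun _ _ => false) L 20 P 0 [] && cover Y L 20 P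

/-! ### Meaning of the evaluation and bit primitives -/

theorem force_eq {α : Type*} (n : ℕ) (f : ℕ → α) : force n f = f n := by
  cases n <;> rfl

theorem forceSet_eq {α : Type*} (n : ℕ) (f : ℕ → α) : forceSet n f = f n := by
  simp only [forceSet, force_eq, tagged]

theorem forceList_eq {α : Type*} (l : List ℕ) (f : List ℕ → α) : forceList l f = f l := by
  induction l generalizing f with
  | nil => rfl
  | cons n l ih =>
    have h : forceList (n :: l) f = force n fun n => forceList l fun l => f (n :: l) := rfl
    rw [h, force_eq, ih]

theorem bit_eq_testBit (A p : ℕ) : bit A p = A.testBit p := by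
  have h : bit A p = Nat.beq ((A >>> p) &&& 1) 1 := rfl
  rw [h, Nat.testBit, Nat.and_comm 1, Nat.and_one_is_mod]
  rcases Nat.mod_two_eq_zero_or_one (A >>> p) with h | h <;> rw [h] <;> rfl

theorem testBit_bits (l : List ℕ) (n : ℕ) : (bits l).testBit n = true ↔ n ∈ l := by
  induction l with
  | nil => simp [bits]
  | cons i l ih =>
    have h : bits (i :: l) = (1 <<< i) ||| bits l := rfl
    rw [h, Nat.testBit_or, Bool.or_eq_true, ih, Nat.one_shiftLeft, Nat.testBit_two_pow]
    simp [eq_comm]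

/-! ### Arithmetic of codes -/

/-- The code of the zero vector with `k` coordinates. -/
def center : ℕ → ℕ
  | 0 => 0
  | k + 1 => center k + 2 * 5 ^ k

theorem center_six : center 6 = 7812 := by decide

section Eval

variable {G : Type*} [AddCommGroup G]

/-- The linear combination of the values of `s` whose coefficients are coded by `n`. -/
def eval (s : ℕ → G) : ℕ → ℕ → G
  | 0, _ => 0
  | k + 1, n => eval s k (n % 5 ^ k) + (((n / 5 ^ k : ℕ) : ℤ) - 2) • s k

/-- The vectors coded by `n` and `m` have `k` coordinates and differ by at most `2` in each. -/
def Close : ℕ → ℕ → ℕ → Prop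
  | 0, n, m => n = 0 ∧ m = 0
  | k + 1, n, m => n / 5 ^ k < 5 ∧ m / 5 ^ k < 5 ∧ n / 5 ^ k ≤ m / 5 ^ k + 2 ∧
      m / 5 ^ k ≤ n / 5 ^ k + 2 ∧ Close k (n % 5 ^ k) (m % 5 ^ k)

/-- The last two inequalities say that `n + center k - m` is again a code below `5 ^ k`, so lower
digits neither borrow from nor carry into the next one. -/
theorem Close.bounds {k n m : ℕ} (h : Close k n m) :
    n < 5 ^ k ∧ m < 5 ^ k ∧ m ≤ n + center k ∧ n + center k < m + 5 ^ k := by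
  induction k generalizing n m with
  | zero => obtain ⟨rfl, rfl⟩ := h; simp [center]
  | succ k ih =>
    obtain ⟨h1, h2, h3, h4, h5⟩ := h
    obtain ⟨i1, i2, i3, i4⟩ := ih h5
    have hn := Nat.mod_add_div n (5 ^ k)
    have hm := Nat.mod_add_div m (5 ^ k)
    rw [center, pow_succ]
    generalize 5 ^ k = w at *
    generalize n / w = a at *
    generalize m / w = b at *
    have e1 : w * a ≤ w * (b + 2) := Nat.mul_le_mul_left _ h3
    have e2 : w * b ≤ w * (a + 2) := Nat.mul_le_mul_left _ h4
    have e3 : w * a ≤ w * 4 := Nat.mul_le_mul_left _ (by omega)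
    have e4 : w * b ≤ w * 4 := Nat.mul_le_mul_left _ (by omega)
    rw [mul_add] at e1 e2
    refine ⟨?_, ?_, ?_, ?_⟩ <;> omega

theorem div_mod_of_eq {t t' w r : ℕ} (h : t = t' + w * r) (h' : t' < w) :
    t / w = r ∧ t % w = t' := by
  subst h
  exact ⟨by rw [Nat.add_mul_div_left _ _ (by omega), Nat.div_eq_of_lt h', zero_add],
    by rw [Nat.add_mul_mod_self_left, Nat.mod_eq_of_lt h']⟩

/-- Evaluation is compatible with the subtraction of codes without carry. -/
theorem Close.eval_sub (s : ℕ → G) {k n m t : ℕ} (h : Close k n m) (ht : t + m = n + center k) :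
    eval s k t = eval s k n - eval s k m := by
  induction k generalizing n m t with
  | zero => simp [eval]
  | succ k ih =>
    obtain ⟨-, -, h3, h4, h5⟩ := h
    obtain ⟨-, -, i3, i4⟩ := h5.bounds
    have hn := Nat.mod_add_div n (5 ^ k)
    have hm := Nat.mod_add_div m (5 ^ k)
    obtain ⟨r, hr⟩ : ∃ r, r + m / 5 ^ k = n / 5 ^ k + 2 := ⟨_, Nat.sub_add_cancel h4⟩
    have key : t = (n % 5 ^ k + center k - m % 5 ^ k) + 5 ^ k * r := by
      have e : 5 ^ k * r + 5 ^ k * (m / 5 ^ k) = 5 ^ k * (n / 5 ^ k) + 5 ^ k * 2 := by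
        rw [← mul_add, hr, mul_add]
      rw [center] at ht
      omega
    obtain ⟨d1, d2⟩ := div_mod_of_eq key (by omega)
    have e := ih h5 (t := n % 5 ^ k + center k - m % 5 ^ k) (by omega)
    have hr' : ((r : ℕ) : ℤ) - 2 = (((n / 5 ^ k : ℕ) : ℤ) - 2) - (((m / 5 ^ k : ℕ) : ℤ) - 2) := by
      have := congrArg (Nat.cast : ℕ → ℤ) hr
      push_cast at this ⊢
      linarith
    rw [eval, eval, eval, d1, d2, e, hr', sub_smul]
    abel

theorem center_lt (k : ℕ) : center k < 5 ^ k := by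
  induction k with
  | zero => simp [center]
  | succ k ih => rw [center, pow_succ]; omega

theorem center_div_mod (k : ℕ) : center (k + 1) / 5 ^ k = 2 ∧ center (k + 1) % 5 ^ k = center k :=
  div_mod_of_eq (by rw [center]; ring) (center_lt k)

theorem close_center {k m : ℕ} (h : m < 5 ^ k) : Close k (center k) m := by
  induction k generalizing m with
  | zero => exact ⟨rfl, by simpa using h⟩
  | succ k ih =>
    have hm : m / 5 ^ k < 5 := Nat.div_lt_of_lt_mul (by rwa [← pow_succ])
    obtain ⟨c1, c2⟩ := center_div_mod k
    rw [Close, c1, c2]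
    exact ⟨by norm_num, hm, Nat.le_add_left _ _, Nat.le_of_lt_succ hm,
      ih (Nat.mod_lt _ (by positivity))⟩

theorem eval_center (s : ℕ → G) (k : ℕ) : eval s k (center k) = 0 := by
  simpa using (close_center (center_lt k)).eval_sub s rfl

/-- Opposite codes have opposite values. -/
theorem eval_opposite (s : ℕ → G) {d : ℕ} (hd : d ≤ 7812) :
    eval s 6 (7812 + d) = - eval s 6 (7812 - d) := by
  have h := (close_center (k := 6) (m := 7812 - d) (by omega)).eval_sub s
    (t := 7812 + d) (by rw [center_six]; omega)
  rwa [eval_center, zero_sub] at h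

/-! ### Points -/

theorem sum_pow_split {k : ℕ} {T : Finset ℕ} (hT : T ⊆ Finset.range (k + 1)) :
    ∃ e : ℕ, e ≤ 1 ∧ ∃ U ⊆ Finset.range k, (∑ i ∈ T, 5 ^ i : ℕ) = ∑ i ∈ U, 5 ^ i + 5 ^ k * e ∧
      ∀ s : ℕ → G, ∑ i ∈ T, s i = ∑ i ∈ U, s i + (e : ℤ) • s k := by
  have hU : T.erase k ⊆ Finset.range k := fun i hi => by
    have := hT (Finset.mem_of_mem_erase hi)
    have := Finset.ne_of_mem_erase hi
    simp only [Finset.mem_range] at *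
    omega
  by_cases hk : k ∈ T
  · refine ⟨1, le_rfl, _, hU, ?_, fun s => ?_⟩
    · rw [← Finset.sum_erase_add _ _ hk, mul_one]
    · rw [← Finset.sum_erase_add _ _ hk]; simp
  · rw [Finset.erase_eq_of_notMem hk] at hU
    exact ⟨0, zero_le_one, _, hU, by simp, fun s => by simp⟩

theorem point_lt {k : ℕ} {T : Finset ℕ} (hT : T ⊆ Finset.range k) :
    center k + ∑ i ∈ T, 5 ^ i < 5 ^ k := by
  induction k generalizing T with
  | zero => simp [center, Finset.subset_empty.1 hT]
  | succ k ih =>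
    obtain ⟨e, he, U, hU, h, -⟩ := sum_pow_split (G := ℤ) hT
    have := ih hU
    have : 5 ^ k * e ≤ 5 ^ k * 1 := Nat.mul_le_mul_left _ he
    rw [h, center, pow_succ]
    omega

theorem point_div_mod {k e : ℕ} {U : Finset ℕ} (hU : U ⊆ Finset.range k) :
    (center (k + 1) + (∑ i ∈ U, 5 ^ i + 5 ^ k * e)) / 5 ^ k = 2 + e ∧
      (center (k + 1) + (∑ i ∈ U, 5 ^ i + 5 ^ k * e)) % 5 ^ k = center k + ∑ i ∈ U, 5 ^ i :=
  div_mod_of_eq (by rw [center]; ring) (point_lt hU)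

theorem eval_point (s : ℕ → G) {k : ℕ} {T : Finset ℕ} (hT : T ⊆ Finset.range k) :
    eval s k (center k + ∑ i ∈ T, 5 ^ i) = ∑ i ∈ T, s i := by
  induction k generalizing T with
  | zero => simp [eval, Finset.subset_empty.1 hT]
  | succ k ih =>
    obtain ⟨e, he, U, hU, h, hs⟩ := sum_pow_split (G := G) hT
    obtain ⟨d1, d2⟩ := point_div_mod (e := e) hU
    rw [h, eval, d1, d2, ih hU, hs s]
    push_cast
    rw [add_sub_cancel_left]

/-- Every digit of the code of a subset sum is 2 or 3, so digits differ by at most 1. -/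
theorem close_point {k : ℕ} {T T' : Finset ℕ} (hT : T ⊆ Finset.range k)
    (hT' : T' ⊆ Finset.range k) :
    Close k (center k + ∑ i ∈ T, 5 ^ i) (center k + ∑ i ∈ T', 5 ^ i) := by
  induction k generalizing T T' with
  | zero => simp [Close, center, Finset.subset_empty.1 hT, Finset.subset_empty.1 hT']
  | succ k ih =>
    obtain ⟨e, he, U, hU, h, -⟩ := sum_pow_split (G := ℤ) hT
    obtain ⟨e', he', U', hU', h', -⟩ := sum_pow_split (G := ℤ) hT'
    obtain ⟨d1, d2⟩ := point_div_mod (e := e) hU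
    obtain ⟨d1', d2'⟩ := point_div_mod (e := e') hU'
    rw [h, h', Close, d1, d2, d1', d2']
    exact ⟨by omega, by omega, by omega, by omega, ih hU hU'⟩

theorem mem_points {k n : ℕ} :
    n ∈ points k ↔ ∃ T ⊆ Finset.range k, n = ∑ i ∈ T, 5 ^ i := by
  induction k generalizing n with
  | zero => simp [points, Finset.subset_empty]
  | succ k ih =>
    have hp : points (k + 1) = points k ++ (points k).map fun n => n + 5 ^ k := rfl
    rw [hp, List.mem_append, List.mem_map, ih]
    constructor
    · rintro (⟨T, hT, rfl⟩ | ⟨m, hm, rfl⟩)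
      · exact ⟨T, hT.trans (Finset.range_subset_range.2 k.le_succ), rfl⟩
      · obtain ⟨T, hT, rfl⟩ := ih.1 hm
        have hk : k ∉ T := fun h => by simpa using hT h
        refine ⟨insert k T, ?_, by rw [Finset.sum_insert hk, add_comm]⟩
        rw [Finset.range_add_one]
        exact Finset.insert_subset_insert _ hT
    · rintro ⟨T, hT, rfl⟩
      obtain ⟨e, he, U, hU, h, -⟩ := sum_pow_split (G := ℤ) hT
      obtain rfl | rfl : e = 0 ∨ e = 1 := by omega
      · exact Or.inl ⟨U, hU, by simpa using h⟩
      · exact Or.inr ⟨_, ih.2 ⟨U, hU, rfl⟩, by simpa using h.symm⟩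

theorem le_of_mem_points {p : ℕ} (hp : p ∈ points 6) : p ≤ 7812 := by
  obtain ⟨T, hT, rfl⟩ := mem_points.1 hp
  have := point_lt hT
  rw [center_six] at this
  omega

/-- The value of a difference of points. -/
theorem eval_sub_points (s : ℕ → G) {t p q : ℕ} (hp : p ∈ points 6) (hq : q ∈ points 6)
    (ht : t + q = p + 7812) : eval s 6 t = eval s 6 (7812 + p) - eval s 6 (7812 + q) := by
  obtain ⟨T, hT, rfl⟩ := mem_points.1 hp
  obtain ⟨U, hU, rfl⟩ := mem_points.1 hq
  have h := close_point hT hU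
  rw [center_six] at h
  exact h.eval_sub s (by rw [center_six]; omega)

theorem eval_sub_sums (s : ℕ → G) {t : ℕ} {T U : Finset ℕ} (hT : T ⊆ Finset.range 6)
    (hU : U ⊆ Finset.range 6) (ht : t + ∑ i ∈ U, 5 ^ i = ∑ i ∈ T, 5 ^ i + 7812) :
    eval s 6 t = ∑ i ∈ T, s i - ∑ i ∈ U, s i := by
  rw [eval_sub_points s (mem_points.2 ⟨T, hT, rfl⟩) (mem_points.2 ⟨U, hU, rfl⟩) ht,
    ← center_six, eval_point s hT, eval_point s hU]

/-! ### Translations -/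

theorem testBit_layers {b w q r n : ℕ} (h : (layers b w q r).testBit n = true) :
    ∃ j < r, j ≤ q + 2 ∧ q ≤ j + 2 ∧ j * w ≤ n ∧ b.testBit (n - j * w) = true := by
  induction r with
  | zero => simp [layers] at h
  | succ r ih =>
    have e : layers b w q (r + 1) = cond (Nat.ble r (q + 2)) (cond (Nat.ble q (r + 2))
      ((b <<< (r * w)) ||| layers b w q r) (layers b w q r)) (layers b w q r) := rfl
    have lift : (layers b w q r).testBit n = true → ∃ j < r + 1, j ≤ q + 2 ∧ q ≤ j + 2 ∧
        j * w ≤ n ∧ b.testBit (n - j * w) = true := fun h => by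
      obtain ⟨j, hj, h⟩ := ih h
      exact ⟨j, by omega, h⟩
    rw [e] at h
    cases h1 : Nat.ble r (q + 2) with
    | false => rw [h1] at h; exact lift h
    | true =>
      cases h2 : Nat.ble q (r + 2) with
      | false => rw [h1, h2] at h; exact lift h
      | true =>
        rw [h1, h2, cond_true, cond_true, Nat.testBit_or, Bool.or_eq_true,
          Nat.testBit_shiftLeft, Bool.and_eq_true, decide_eq_true_eq] at h
        rcases h with h | h
        · exact ⟨r, r.lt_succ_self, Nat.le_of_ble_eq_true h1, Nat.le_of_ble_eq_true h2, h.1, h.2⟩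
        · exact lift h

theorem close_of_testBit_mask {k m n : ℕ} (hm : m < 5 ^ k) (h : (mask k m).testBit n = true) :
    Close k n m := by
  induction k generalizing m n with
  | zero =>
    have h' : (1 : ℕ).testBit n = true := h
    rw [Nat.testBit_one_eq_true_iff_self_eq_zero] at h'
    exact ⟨h', by simpa using hm⟩
  | succ k ih =>
    have e : mask (k + 1) m = layers (mask k (m % 5 ^ k)) (5 ^ k) (m / 5 ^ k) 5 := by
      have : mask (k + 1) m = force (Nat.pow 5 k) fun w => force (mask k (Nat.mod m w)) fun b =>
        force (Nat.div m w) fun q => layers b w q 5 := rfl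
      rw [this, force_eq, force_eq, force_eq]
      rfl
    rw [e] at h
    obtain ⟨j, hj, h1, h2, h3, h4⟩ := testBit_layers h
    have hc := ih (Nat.mod_lt _ (by positivity)) h4
    obtain ⟨d1, d2⟩ := div_mod_of_eq (t := n) (t' := n - j * 5 ^ k) (w := 5 ^ k) (r := j)
      (by rw [mul_comm (5 ^ k)]; omega) hc.bounds.1
    have hm' : m / 5 ^ k < 5 := Nat.div_lt_of_lt_mul (by rwa [← pow_succ])
    rw [Close, d1, d2]
    exact ⟨hj, hm', h1, h2, hc⟩

/-- A translation under which values are invariant, together with its mask. -/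
def IsPeriod (s : ℕ → G) (r : ℕ × ℕ) : Prop :=
  r.1 ≤ 7812 ∧ r.2 = mask 6 (7812 - r.1) ∧ eval s 6 (7812 - r.1) = 0

/-- The mask is centred at the code of the negated relation, so it holds just those vectors to which
the relation can be added with entries staying in `[-2, 2]`. -/
theorem IsPeriod.eval_add {s : ℕ → G} {r : ℕ × ℕ} (hr : IsPeriod s r) {n : ℕ}
    (hn : r.2.testBit n = true) : eval s 6 (n + r.1) = eval s 6 n := by
  obtain ⟨h1, h2, h3⟩ := hr
  rw [h2] at hn
  have hc := close_of_testBit_mask (by omega) hn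
  rw [hc.eval_sub s (t := n + r.1) (by rw [center_six]; omega), h3, sub_zero]

theorem testBit_translate {s : ℕ → G} {r : ℕ × ℕ} (hr : IsPeriod s r) {A n : ℕ}
    (h : (translate A r.1 r.2).testBit n = true) :
    ∃ m, A.testBit m = true ∧ eval s 6 n = eval s 6 m := by
  have e : translate A r.1 r.2 = ((A &&& r.2) <<< r.1) ||| (A ||| ((A >>> r.1) &&& r.2)) := rfl
  rw [e, Nat.testBit_or, Nat.testBit_or, Nat.testBit_and, Nat.testBit_shiftLeft, Nat.testBit_and,
    Nat.testBit_shiftRight] at h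
  simp only [Bool.or_eq_true, Bool.and_eq_true, decide_eq_true_eq] at h
  rcases h with ⟨h1, h2, h3⟩ | h | ⟨h1, h2⟩
  · refine ⟨_, h2, ?_⟩
    have := hr.eval_add h3
    rwa [Nat.sub_add_cancel h1] at this
  · exact ⟨n, h, rfl⟩
  · exact ⟨_, h1, by rw [add_comm, hr.eval_add h2]⟩

theorem testBit_saturate {s : ℕ → G} {g : List (ℕ × ℕ)} (hg : ∀ r ∈ g, IsPeriod s r) {A n : ℕ}
    (h : (saturate g A).testBit n = true) :
    ∃ m, A.testBit m = true ∧ eval s 6 n = eval s 6 m := by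
  induction g generalizing A with
  | nil => exact ⟨n, h, rfl⟩
  | cons r g ih =>
    have e : saturate (r :: g) A = saturate g (translate A r.1 r.2) := forceSet_eq _ _
    rw [e] at h
    obtain ⟨m, hm, h1⟩ := ih (fun r' h' => hg r' (List.mem_cons_of_mem _ h')) h
    obtain ⟨m', hm', h2⟩ := testBit_translate (hg r List.mem_cons_self) hm
    exact ⟨m', hm', h1.trans h2⟩

/-- All vectors in `Y` vanish. -/
def Vanish (s : ℕ → G) (Y : ℕ) : Prop := ∀ n, Y.testBit n = true → eval s 6 n = 0

/-- No vector in `N` vanishes. -/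
def NonVanish (s : ℕ → G) (N : ℕ) : Prop := ∀ n, N.testBit n = true → eval s 6 n ≠ 0

theorem Vanish.saturate {s : ℕ → G} {g : List (ℕ × ℕ)} (hg : ∀ r ∈ g, IsPeriod s r) {Y : ℕ}
    (hY : Vanish s Y) : Vanish s (saturate g Y) := fun n hn => by
  obtain ⟨m, hm, h⟩ := testBit_saturate hg hn
  rw [h, hY m hm]

theorem NonVanish.saturate {s : ℕ → G} {g : List (ℕ × ℕ)} (hg : ∀ r ∈ g, IsPeriod s r) {N : ℕ}
    (hN : NonVanish s N) : NonVanish s (saturate g N) := fun n hn => by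
  obtain ⟨m, hm, h⟩ := testBit_saturate hg hn
  rw [h]
  exact hN m hm

theorem Vanish.lor {s : ℕ → G} {A B : ℕ} (hA : Vanish s A) (hB : Vanish s B) :
    Vanish s (Nat.lor A B) := fun n hn => by
  have h : (A ||| B).testBit n = true := hn
  rw [Nat.testBit_or, Bool.or_eq_true] at h
  exact h.elim (hA n) (hB n)

theorem NonVanish.lor {s : ℕ → G} {A B : ℕ} (hA : NonVanish s A) (hB : NonVanish s B) :
    NonVanish s (Nat.lor A B) := fun n hn => by
  have h : (A ||| B).testBit n = true := hn
  rw [Nat.testBit_or, Bool.or_eq_true] at h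
  exact h.elim (hA n) (hB n)

theorem testBit_pair {d n : ℕ} (h : (pair d).testBit n = true) : n = 7812 - d ∨ n = 7812 + d := by
  have e : pair d = 2 ^ (7812 - d) ||| 2 ^ (7812 + d) := by
    rw [← Nat.one_shiftLeft, ← Nat.one_shiftLeft]; rfl
  rw [e, Nat.testBit_or, Bool.or_eq_true, Nat.testBit_two_pow, Nat.testBit_two_pow] at h
  simp only [decide_eq_true_eq] at h
  omega

theorem vanish_pair {s : ℕ → G} {d : ℕ} (hd : d ≤ 7812) (h : eval s 6 (7812 - d) = 0) :
    Vanish s (pair d) := fun n hn => by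
  rcases testBit_pair hn with rfl | rfl
  · exact h
  · rw [eval_opposite s hd, h, neg_zero]

theorem nonVanish_pair {s : ℕ → G} {d : ℕ} (hd : d ≤ 7812) (h : eval s 6 (7812 - d) ≠ 0) :
    NonVanish s (pair d) := fun n hn => by
  rcases testBit_pair hn with rfl | rfl
  · exact h
  · rw [eval_opposite s hd]; exact neg_ne_zero.2 h

end Eval

/-! ### Soundness of the search -/

section Sound

variable {G : Type*} [AddCommGroup G]

theorem testBit_around {A p v : ℕ} (h : (around A p).testBit v = true) :
    A.testBit (7812 - p + v) = true := by
  have e : around A p = A >>> (7812 - p) := rfl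
  rwa [e, Nat.testBit_shiftRight] at h

/-- Each chosen point cuts the candidates down to those whose difference from it lies in `N`, so
later choices have different sums. The mask `M` and list `Q` only guide the continuation and need no
invariant. -/
theorem clique_sound {s : ℕ → G} {N : ℕ} (hN : NonVanish s N) {k : ℕ → List ℕ → Bool}
    {l : List ℕ} (hl : ∀ p ∈ l, p ∈ points 6) {f C M : ℕ} {Q : List ℕ}
    (h : clique N k l f C M Q = true) :
    (∃ M Q, k M Q = true) ∨ ∃ R : List ℕ, R.length = f ∧
      (∀ p ∈ R, p ∈ points 6 ∧ C.testBit p = true) ∧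
      R.Pairwise fun p q => eval s 6 (7812 + p) ≠ eval s 6 (7812 + q) := by
  induction l generalizing f C M Q with
  | nil =>
    cases f with
    | zero => exact Or.inr ⟨[], rfl, by simp, List.Pairwise.nil⟩
    | succ f => exact Or.inl ⟨M, Q, h⟩
  | cons p l ih =>
    cases f with
    | zero => exact Or.inr ⟨[], rfl, by simp, List.Pairwise.nil⟩
    | succ f =>
      have hl' : ∀ p ∈ l, p ∈ points 6 := fun q hq => hl q (List.mem_cons_of_mem _ hq)
      have hp := hl p List.mem_cons_self
      have e : clique N k (p :: l) (f + 1) C M Q = cond (bit C p)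
          (forceSet (Nat.land C (around N p)) fun C =>
            forceSet (Nat.lor M (Nat.shiftLeft 1 p)) fun M =>
            force f fun f => clique N k l f C M (p :: Q))
          (clique N k l (f + 1) C M Q) := rfl
      rw [e, forceSet_eq, forceSet_eq, force_eq, bit_eq_testBit] at h
      cases hC : C.testBit p with
      | false => rw [hC] at h; exact ih hl' h
      | true =>
        rw [hC] at h
        refine (ih hl' h).imp_right ?_
        rintro ⟨R, h1, h2, h3⟩
        have h2' : ∀ q ∈ R, C.testBit q = true ∧ (around N p).testBit q = true := fun q hq => by
          have : (C &&& around N p).testBit q = true := (h2 q hq).2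
          rwa [Nat.testBit_and, Bool.and_eq_true] at this
        refine ⟨p :: R, by simp [h1], ?_, List.pairwise_cons.2 ⟨fun q hq heq => ?_, h3⟩⟩
        · intro q hq
          rcases List.mem_cons.1 hq with rfl | hq
          · exact ⟨hp, hC⟩
          · exact ⟨(h2 q hq).1, (h2' q hq).1⟩
        · have hle := le_of_mem_points hp
          have := hN _ (testBit_around (h2' q hq).2)
          rw [eval_sub_points s (h2 q hq).1 hp (by omega), heq, sub_self] at this
          exact this rfl

theorem nonVanish_bits_append {s : ℕ → G} {l l' : List ℕ} (h : NonVanish s (bits l))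
    (h' : NonVanish s (bits l')) : NonVanish s (bits (l ++ l')) := fun n hn => by
  rw [testBit_bits, List.mem_append] at hn
  exact hn.elim (fun hn => h n ((testBit_bits _ _).2 hn)) fun hn => h' n ((testBit_bits _ _).2 hn)

variable [DecidableEq G]

/-- The sums of `s` over the subsets of `{0, …, 5}`. -/
def sums (s : ℕ → G) : Finset G := (Finset.range 6).powerset.image fun T => ∑ i ∈ T, s i

theorem mem_sums_iff {s : ℕ → G} {x : G} :
    x ∈ sums s ↔ ∃ p ∈ points 6, eval s 6 (7812 + p) = x := by
  simp only [sums, Finset.mem_image, Finset.mem_powerset]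
  constructor
  · rintro ⟨T, hT, rfl⟩
    exact ⟨_, mem_points.2 ⟨T, hT, rfl⟩, by rw [← center_six, eval_point s hT]⟩
  · rintro ⟨p, hp, rfl⟩
    obtain ⟨T, hT, rfl⟩ := mem_points.1 hp
    exact ⟨T, hT, by rw [← center_six, eval_point s hT]⟩

theorem le_card_sums {s : ℕ → G} {R : List ℕ} (h : ∀ p ∈ R, p ∈ points 6)
    (hR : R.Pairwise fun p q => eval s 6 (7812 + p) ≠ eval s 6 (7812 + q)) :
    R.length ≤ (sums s).card := by
  have hn : (R.map fun p => eval s 6 (7812 + p)).Nodup := List.pairwise_map.2 hR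
  rw [← List.length_map (f := fun p => eval s 6 (7812 + p)), ← List.toFinset_card_of_nodup hn]
  refine Finset.card_le_card fun x hx => ?_
  obtain ⟨p, hp, rfl⟩ := List.mem_map.1 (List.mem_toFinset.1 hx)
  exact mem_sums_iff.2 ⟨p, h p hp, rfl⟩

/-- Branching on whether a vector vanishes is exhaustive whichever vector is taken, so nothing about
`pick` has to be proved beyond the checked bound `d ≤ 7812`. -/
theorem search_sound {s : ℕ → G} (hs : (sums s).card ≤ 20) {P : ℕ} {L : List ℕ}
    (hL : ∀ p ∈ L, p ∈ points 6) {form : ℕ → Bool} {goal : Prop}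
    (hform : ∀ Y, Vanish s Y → form Y = true → goal) {f Y N : ℕ} {g : List (ℕ × ℕ)}
    (hY : Vanish s Y) (hN : NonVanish s N) (hg : ∀ r ∈ g, IsPeriod s r)
    (h : search P L form f Y N g = true) : goal := by
  induction f generalizing Y N g with
  | zero => exact absurd h Bool.false_ne_true
  | succ f ih =>
    have e : search P L form (f + 1) Y N g = forceSet Y fun Y => forceSet (saturate g N) fun N =>
      cond (Nat.beq (Nat.land Y N) 0)
        (clique N (fun M Q => force (pick M Y N Q L 0) fun d =>
          cond (Nat.beq d 0) (form Y)
            (cond (Nat.ble d 7812)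
              (forceSet (mask 6 (Nat.sub 7812 d)) fun D => forceSet (pair d) fun B =>
              cond (search P L form f (saturate ((d, D) :: g) (Nat.lor Y B)) N ((d, D) :: g))
                (search P L form f Y (Nat.lor N B) g) false) false)) L 21 P 0 [])
        true := rfl
    rw [e, forceSet_eq, forceSet_eq] at h
    have hN' := hN.saturate hg
    generalize saturate g N = N' at h hN'
    cases hYN : Nat.beq (Nat.land Y N') 0 with
    | false =>
      obtain ⟨n, hn⟩ := Nat.exists_testBit_of_ne_zero (x := Y &&& N') (Nat.ne_of_beq_eq_false hYN)
      rw [Nat.testBit_and, Bool.and_eq_true] at hn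
      exact absurd (hY n hn.1) (hN' n hn.2)
    | true =>
      rw [hYN, cond_true] at h
      rcases clique_sound hN' hL h with ⟨M, Q, h⟩ | ⟨R, h1, h2, h3⟩
      · rw [force_eq] at h
        generalize pick M Y N' Q L 0 = d at h
        cases hd : Nat.beq d 0 with
        | true => rw [hd] at h; exact hform Y hY h
        | false =>
          rw [hd, cond_false] at h
          cases hd' : Nat.ble d 7812 with
          | false => rw [hd'] at h; exact absurd h Bool.false_ne_true
          | true =>
            have hle := Nat.le_of_ble_eq_true hd'
            rw [hd', cond_true, forceSet_eq, forceSet_eq, Bool.cond_false_right,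
              Bool.and_eq_true] at h
            by_cases h0 : eval s 6 (7812 - d) = 0
            · have hg' : ∀ r ∈ (d, mask 6 (Nat.sub 7812 d)) :: g, IsPeriod s r := fun r hr => by
                rcases List.mem_cons.1 hr with rfl | hr
                · exact ⟨hle, rfl, h0⟩
                · exact hg r hr
              exact ih ((hY.lor (vanish_pair hle h0)).saturate hg') hN' hg' h.1
            · exact ih hY (hN'.lor (nonVanish_pair hle h0)) hg h.2
      · have := le_card_sums (fun p hp => (h2 p hp).1) h3
        omega

theorem searchFrom_sound {s : ℕ → G} (hs : (sums s).card ≤ 20) {goal : Prop}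
    (hform : ∀ Y, Vanish s Y → form Y = true → goal) {g : List ℕ} {N : ℕ}
    (hN : NonVanish s N) (hg : ∀ d ∈ g, d ≤ 7812 ∧ eval s 6 (7812 - d) = 0)
    (h : searchFrom g N = true) : goal := by
  rw [searchFrom, forceSet_eq, forceSet_eq, forceList_eq, forceList_eq] at h
  refine search_sound hs (fun p hp => List.mem_reverse.1 hp) hform (fun n hn => ?_) hN
    (fun r hr => ?_) h
  · rw [testBit_bits, List.mem_cons, List.mem_flatMap] at hn
    rcases hn with rfl | ⟨d, hd, hn⟩
    · rw [← center_six, eval_center]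
    · obtain ⟨h1, h2⟩ := hg d hd
      simp only [List.mem_cons, List.not_mem_nil, or_false] at hn
      rcases hn with rfl | rfl
      · exact h2
      · rw [eval_opposite s h1, h2, neg_zero]
  · obtain ⟨d, hd, rfl⟩ := List.mem_map.1 hr
    exact ⟨(hg d hd).1, rfl, (hg d hd).2⟩

/-! ### Enumerations of zero-sum free sets -/

/-- The values of `s` on `{0, …, 5}` are distinct and form a zero-sum free set. -/
structure IsEnumeration (s : ℕ → G) (S : Finset G) : Prop where
  injOn : Set.InjOn s (Finset.range 6)
  image_eq : (Finset.range 6).image s = S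
  zeroSumFree : IsZeroSumFree S

theorem sum_mem_subsetSums {S T : Finset G} (hT : T ⊆ S) (h : T.Nonempty) :
    ∑ x ∈ T, x ∈ subsetSums S :=
  Finset.mem_image.2 ⟨T, Finset.mem_filter.2 ⟨Finset.mem_powerset.2 hT, h⟩, rfl⟩

namespace IsEnumeration

variable {s : ℕ → G} {S : Finset G}

theorem sum_image (h : IsEnumeration s S) {T : Finset ℕ} (hT : T ⊆ Finset.range 6) :
    ∑ x ∈ T.image s, x = ∑ i ∈ T, s i :=
  Finset.sum_image (h.injOn.mono (by exact_mod_cast hT))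

theorem sum_ne_zero (h : IsEnumeration s S) {T : Finset ℕ} (hT : T ⊆ Finset.range 6) (hne : T.Nonempty) :
    ∑ i ∈ T, s i ≠ 0 := fun h0 => by
  refine h.zeroSumFree ?_
  rw [← h0, ← h.sum_image hT]
  exact sum_mem_subsetSums (h.image_eq ▸ Finset.image_subset_image hT) (hne.image s)

theorem sums_eq (h : IsEnumeration s S) : sums s = insert 0 (subsetSums S) := by
  ext x
  simp only [sums, Finset.mem_image, Finset.mem_powerset, Finset.mem_insert]
  constructor
  · rintro ⟨T, hT, rfl⟩
    rcases T.eq_empty_or_nonempty with rfl | hne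
    · simp
    · right
      rw [← h.sum_image hT]
      exact sum_mem_subsetSums (h.image_eq ▸ Finset.image_subset_image hT) (hne.image s)
  · rintro (rfl | hx)
    · exact ⟨∅, by simp, by simp⟩
    · obtain ⟨T, hT, rfl⟩ := Finset.mem_image.1 hx
      obtain ⟨U, hU, rfl⟩ := Finset.subset_image_iff.1
        (h.image_eq ▸ Finset.mem_powerset.1 (Finset.mem_filter.1 hT).1)
      exact ⟨U, by exact_mod_cast hU, (h.sum_image (by exact_mod_cast hU)).symm⟩

theorem card_sums (h : IsEnumeration s S) : (sums s).card = (subsetSums S).card + 1 := by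
  rw [h.sums_eq, Finset.card_insert_of_notMem h.zeroSumFree]

theorem nonVanish_excluded (h : IsEnumeration s S) : NonVanish s (bits excluded) := fun n hn => by
  rw [testBit_bits, excluded, List.mem_append, List.mem_flatMap, List.mem_flatMap] at hn
  rcases hn with ⟨p, hp, hn⟩ | ⟨i, hi, hn⟩
  · rw [List.mem_filter] at hp
    have hp0 : p ≠ 0 := by simpa using hp.2
    have key : eval s 6 (7812 + p) ≠ 0 := by
      obtain ⟨T, hT, rfl⟩ := mem_points.1 hp.1
      rw [← center_six, eval_point s hT]
      refine h.sum_ne_zero hT (Finset.nonempty_iff_ne_empty.2 ?_)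
      rintro rfl
      simp at hp0
    simp only [List.mem_cons, List.not_mem_nil, or_false] at hn
    rcases hn with rfl | rfl
    · exact key
    · rw [eval_opposite s (le_of_mem_points hp.1)] at key
      exact neg_ne_zero.1 key
  · obtain ⟨j, hj, rfl⟩ := List.mem_map.1 hn
    simp only [List.mem_filter, List.mem_range, decide_eq_true_eq] at hi hj
    have hle : 5 ^ j ≤ 5 ^ 5 := Nat.pow_le_pow_right (by norm_num) (by omega)
    have hpos : 0 < 5 ^ i := by positivity
    rw [eval_sub_sums s (T := {i}) (U := {j}) (by simpa using hi) (by simpa using hj.1)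
      (by simp only [Finset.sum_singleton]; omega), Finset.sum_singleton, Finset.sum_singleton,
      sub_ne_zero]
    exact fun heq => hj.2 (h.injOn (by simpa using hj.1) (by simpa using hi) heq.symm)

theorem nonVanish_triples (h : IsEnumeration s S) (h' : ∀ x ∈ S, ∀ y ∈ S, ∀ z ∈ S, y ≠ z → x ≠ y + z) :
    NonVanish s (bits triples) := fun n hn => by
  simp only [testBit_bits, triples, List.mem_flatMap, List.mem_filter, List.mem_range,
    decide_eq_true_eq, List.mem_cons, List.not_mem_nil, or_false] at hn
  obtain ⟨i, hi, j, hj, k, ⟨hk, hki, hjk, hji⟩, hn⟩ := hn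
  have hmem : ∀ i, i < 6 → s i ∈ S := fun i hi => by
    rw [← h.image_eq]
    exact Finset.mem_image_of_mem s (Finset.mem_range.2 hi)
  have hle : ∀ i, i < 6 → 0 < 5 ^ i ∧ 5 ^ i ≤ 5 ^ 5 := fun i hi =>
    ⟨by positivity, Nat.pow_le_pow_right (by norm_num) (by omega)⟩
  have hi' := hle i hi
  have hj' := hle j hj
  have hk' := hle k hk
  have hT : {j, k} ⊆ Finset.range 6 := by
    intro x hx
    simp only [Finset.mem_insert, Finset.mem_singleton, Finset.mem_range] at hx ⊢
    omega
  have hU : {i} ⊆ Finset.range 6 := by simpa using hi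
  have key : s i ≠ s j + s k := h' _ (hmem i hi) _ (hmem j hj) _ (hmem k hk) fun heq =>
    hjk.ne (h.injOn (by simpa using hj) (by simpa using hk) heq)
  rcases hn with rfl | rfl
  · rw [eval_sub_sums s hU hT (by
      rw [Finset.sum_pair hjk.ne, Finset.sum_singleton]; omega), Finset.sum_pair hjk.ne,
      Finset.sum_singleton, sub_ne_zero]
    exact key
  · rw [eval_sub_sums s hT hU (by
      rw [Finset.sum_pair hjk.ne, Finset.sum_singleton]; omega), Finset.sum_pair hjk.ne,
      Finset.sum_singleton, sub_ne_zero]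
    exact key.symm

end IsEnumeration

end Sound

/-! ### From relations to the five forms -/

section Forms

variable {G : Type*} [AddCommGroup G]

theorem weight_eq {l : List ℕ} (hl : l.Nodup) : weight l = ∑ i ∈ l.toFinset, 5 ^ i := by
  rw [List.sum_toFinset _ hl]
  clear hl
  induction l with
  | nil => rfl
  | cons i l ih =>
    rw [List.map_cons, List.sum_cons, ← ih]
    rfl

theorem toFinset_subset_range {l : List ℕ} (hl : ∀ i ∈ l, i < 6) :
    l.toFinset ⊆ Finset.range 6 := fun i hi =>
  Finset.mem_range.2 (hl i (List.mem_toFinset.1 hi))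

theorem eval_of_weight (s : ℕ → G) {p q : List ℕ} (hp : p.Nodup) (hq : q.Nodup)
    (hp' : ∀ i ∈ p, i < 6) (hq' : ∀ i ∈ q, i < 6) {t : ℕ} (ht : t + weight q = weight p + 7812) :
    eval s 6 t = (p.map s).sum - (q.map s).sum := by
  rw [weight_eq hp, weight_eq hq] at ht
  rw [eval_sub_sums s (toFinset_subset_range hp') (toFinset_subset_range hq') ht,
    List.sum_toFinset _ hp, List.sum_toFinset _ hq]

theorem weight_le {l : List ℕ} (hl : l.Nodup) (hl' : ∀ i ∈ l, i < 6) : weight l ≤ 7812 :=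
  le_of_mem_points (mem_points.2 ⟨_, toFinset_subset_range hl', weight_eq hl⟩)

theorem rel_sound {s : ℕ → G} {Y : ℕ} (hY : Vanish s Y) {p q : List ℕ} (hn : (p ++ q).Nodup)
    (hl : ∀ i ∈ p ++ q, i < 6) (h : rel Y p q = true) : (p.map s).sum = (q.map s).sum := by
  have e : rel Y p q = bit Y (weight p + 7812 - weight q) := rfl
  rw [e, bit_eq_testBit] at h
  obtain ⟨hp, hq, -⟩ := List.nodup_append.1 hn
  have hp' := fun i hi => hl i (List.mem_append_left q hi)
  have hq' := fun i hi => hl i (List.mem_append_right p hi)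
  have := weight_le hq hq'
  rw [← sub_eq_zero, ← eval_of_weight s hp hq hp' hq' (t := weight p + 7812 - weight q) (by omega)]
  exact hY _ h

theorem anyIndex_eq_true {f : ℕ → Bool} : anyIndex f = true ↔ ∃ i < 6, f i = true := by
  rw [anyIndex, List.any_eq_true]
  refine exists_congr fun i => and_congr_left fun _ => ?_
  simp only [List.mem_cons, List.not_mem_nil, or_false]
  omega

theorem addOrderOf_eq_twenty {x : G} (h4 : 4 • x ≠ 0) (h10 : 10 • x ≠ 0) (h : 20 • x = 0) :
    addOrderOf x = 20 := by
  refine addOrderOf_eq_of_nsmul_and_div_prime_nsmul (by norm_num) h fun p hp hd => ?_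
  have hle : p ≤ 20 := Nat.le_of_dvd (by norm_num) hd
  -- The prime divisors 2 and 5 of 20 leave the multiples 10 and 4.
  interval_cases p <;> first | exact h4 | exact h10 | (exfalso; revert hp hd; decide)

theorem addOrderOf_eq_ten {x : G} (h2 : 2 • x ≠ 0) (h5 : 5 • x ≠ 0) (h : 10 • x = 0) :
    addOrderOf x = 10 := by
  refine addOrderOf_eq_of_nsmul_and_div_prime_nsmul (by norm_num) h fun p hp hd => ?_
  have hle : p ≤ 10 := Nat.le_of_dvd (by norm_num) hd
  interval_cases p <;> first | exact h2 | exact h5 | (exfalso; revert hp hd; decide)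

variable [DecidableEq G]

/-- The set is one of the five forms of the classification. -/
def HasForm (S : Finset G) : Prop :=
  ∃ x₁ x₂ x₃ : G,
    (S = {x₁, x₂, x₃, x₁ + x₃, x₂ + x₃, x₁ + x₂ + x₃} ∧
      addOrderOf x₁ = 2 ∧ 2 • x₂ ∈ AddSubgroup.zmultiples x₁) ∨
    (S = {x₁, x₂, 2 • x₂, 3 • x₂, x₁ + x₂, x₁ + 2 • x₂} ∧
      addOrderOf x₁ = 2) ∨
    (S = {-(2 • x₁), x₁, 3 • x₁, 4 • x₁, 5 • x₁, 6 • x₁} ∧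
      addOrderOf x₁ = 20) ∨
    (S = {-(3 • x₁), x₁, 4 • x₁, 5 • x₁, 9 • x₁, 12 • x₁} ∧
      addOrderOf x₁ = 20) ∨
    (S = {x₁, x₂, x₁ + x₂, x₁ + 2 • x₂, 2 • x₁ + x₂, 4 • x₁ + 4 • x₂} ∧
      2 • x₁ = 2 • x₂ ∧ addOrderOf x₁ = 10 ∧ addOrderOf x₂ = 10)

namespace IsEnumeration

variable {s : ℕ → G} {S : Finset G}

theorem eq_of_nodup (h : IsEnumeration s S) {a b c d e f : ℕ} (hn : [a, b, c, d, e, f].Nodup)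
    (hl : ∀ i ∈ [a, b, c, d, e, f], i < 6) : S = {s a, s b, s c, s d, s e, s f} := by
  have hr : [a, b, c, d, e, f].toFinset = Finset.range 6 :=
    Finset.eq_of_subset_of_card_le (toFinset_subset_range hl)
      (by rw [List.toFinset_card_of_nodup hn]; simp)
  rw [← h.image_eq, ← hr]
  simp

theorem list_sum_ne_zero (h : IsEnumeration s S) {l : List ℕ} (hn : l.Nodup)
    (hl : ∀ i ∈ l, i < 6) (hne : l ≠ []) : (l.map s).sum ≠ 0 := by
  rw [← List.sum_toFinset _ hn]
  exact h.sum_ne_zero (toFinset_subset_range hl) (by simpa [Finset.nonempty_iff_ne_empty] using hne)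

theorem ne_zero (h : IsEnumeration s S) {i : ℕ} (hi : i < 6) : s i ≠ 0 := by
  simpa using h.list_sum_ne_zero (l := [i]) (by simp) (by simpa using hi) (by simp)

theorem hasForm_of_formTorsion (h : IsEnumeration s S) {Y : ℕ} (hY : Vanish s Y)
    (hf : formTorsion Y = true) : HasForm S := by
  simp only [formTorsion, anyIndex_eq_true, Bool.and_eq_true, Bool.or_eq_true,
    decide_eq_true_eq] at hf
  obtain ⟨a, ha, b, hb, c, hc, h1, h2, hf⟩ := hf
  have : Fact (Nat.Prime 2) := ⟨Nat.prime_two⟩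
  rcases hf with ⟨d, hd, e, he, h3, h4, f, hf, h5, hn⟩ | ⟨d, hd, h3, e, he, h4, f, hf, h5, hn⟩
  · replace h1 := rel_sound hY (by grind) (by simp [*]) h1
    replace h2 := rel_sound hY (by grind) (by simp [*]) h2
    replace h3 := rel_sound hY (by grind) (by simp [*]) h3
    replace h4 := h4.imp (rel_sound hY (by grind) (by simp [*]))
      (rel_sound hY (by grind) (by simp [*]))
    replace h5 := rel_sound hY (by grind) (by simp [*]) h5
    simp only [List.map_cons, List.map_nil, List.sum_cons, List.sum_nil, add_zero] at h1 h2 h3 h4 h5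
    have hS := h.eq_of_nodup hn (by simp [*])
    refine ⟨s a, s d, s b, Or.inl ⟨?_, addOrderOf_eq_prime ?_ (h.ne_zero ha), ?_⟩⟩
    · rw [hS, h1, h3, add_assoc, h3, h5]
    · linear_combination (norm := module) h1 + h2
    · rw [AddSubgroup.mem_zmultiples_iff]
      rcases h4 with h4 | h4
      · exact ⟨0, by linear_combination (norm := module) -(h3 + h4)⟩
      · exact ⟨1, by linear_combination (norm := module) h1 - (h3 + h4)⟩
  · replace h1 := rel_sound hY (by grind) (by simp [*]) h1
    replace h2 := rel_sound hY (by grind) (by simp [*]) h2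
    replace h3 := rel_sound hY (by grind) (by simp [*]) h3
    replace h4 := rel_sound hY (by grind) (by simp [*]) h4
    replace h5 := rel_sound hY (by grind) (by simp [*]) h5
    simp only [List.map_cons, List.map_nil, List.sum_cons, List.sum_nil, add_zero] at h1 h2 h3 h4 h5
    have hS := h.eq_of_nodup hn (by simp [*])
    have ho : 2 • s a = 0 := by linear_combination (norm := module) h1 + h2
    have hd' : s d = s a + 2 • s b := by linear_combination (norm := module) -(h1 + h3)
    have he' : s e = 2 • s b := by linear_combination (norm := module) hd' - h4 + ho
    have hf' : s f = 3 • s b := by linear_combination (norm := module) he' - h5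
    refine ⟨s a, s b, 0, Or.inr (Or.inl ⟨?_, addOrderOf_eq_prime ho (h.ne_zero ha)⟩)⟩
    rw [hS, h1, ← he', ← hf', he', ← hd']

theorem hasForm_of_formCyclic (h : IsEnumeration s S) {Y : ℕ} (hY : Vanish s Y)
    (hf : formCyclic Y = true) : HasForm S := by
  simp only [formCyclic, anyIndex_eq_true, Bool.and_eq_true, decide_eq_true_eq] at hf
  obtain ⟨a, ha, b, hb, c, hc, h1, d, hd, h2, e, he, h3, h4, f, hf, h5, h6, hn⟩ := hf
  -- This sum will be `4x + 6x = 10x`, needed for the order to be exactly 20.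
  have hne := h.list_sum_ne_zero (l := [d, f]) (by grind) (by simp [*]) (by simp)
  replace h1 := rel_sound hY (by grind) (by simp [*]) h1
  replace h2 := rel_sound hY (by grind) (by simp [*]) h2
  replace h3 := rel_sound hY (by grind) (by simp [*]) h3
  replace h4 := rel_sound hY (by grind) (by simp [*]) h4
  replace h5 := rel_sound hY (by grind) (by simp [*]) h5
  replace h6 := rel_sound hY (by grind) (by simp [*]) h6
  simp only [List.map_cons, List.map_nil, List.sum_cons, List.sum_nil, add_zero]
    at h1 h2 h3 h4 h5 h6 hne
  have hS := h.eq_of_nodup hn (by simp [*])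
  have ea : s a = -(2 • s b) := by linear_combination (norm := module) h2 + h3 + h4
  have ec : s c = 3 • s b := by linear_combination (norm := module) h1 - ea
  have ed : s d = 4 • s b := by linear_combination (norm := module) ec - h2
  have ee : s e = 5 • s b := by linear_combination (norm := module) ed - h3
  have ef : s f = 6 • s b := by linear_combination (norm := module) ee - h5
  refine ⟨s b, 0, 0, Or.inr (Or.inr (Or.inl ⟨by rw [hS, ea, ec, ed, ee, ef],
    addOrderOf_eq_twenty ?_ ?_ ?_⟩))⟩
  · exact ed ▸ h.ne_zero hd
  · rwa [ed, ef, ← add_nsmul] at hne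
  · rw [ea, ec, ed, ee, ef] at h6
    linear_combination (norm := module) h6

theorem hasForm_of_formCyclic' (h : IsEnumeration s S) {Y : ℕ} (hY : Vanish s Y)
    (hf : formCyclic' Y = true) : HasForm S := by
  simp only [formCyclic', anyIndex_eq_true, Bool.and_eq_true, decide_eq_true_eq] at hf
  obtain ⟨a, ha, b, hb, c, hc, h1, d, hd, h2, e, he, h3, f, hf, h4, h5, h6, hn⟩ := hf
  -- This sum will be `x + 4x + 5x = 10x`.
  have hne := h.list_sum_ne_zero (l := [b, c, d]) (by grind) (by simp [*]) (by simp)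
  replace h1 := rel_sound hY (by grind) (by simp [*]) h1
  replace h2 := rel_sound hY (by grind) (by simp [*]) h2
  replace h3 := rel_sound hY (by grind) (by simp [*]) h3
  replace h4 := rel_sound hY (by grind) (by simp [*]) h4
  replace h5 := rel_sound hY (by grind) (by simp [*]) h5
  replace h6 := rel_sound hY (by grind) (by simp [*]) h6
  simp only [List.map_cons, List.map_nil, List.sum_cons, List.sum_nil, add_zero]
    at h1 h2 h3 h4 h5 h6 hne
  have hS := h.eq_of_nodup hn (by simp [*])
  have ea' : s a = s b - s c := by linear_combination (norm := module) h1
  have ed' : s d = s c + s b := h2.symm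
  have ee' : s e = 2 • s c + s b := by linear_combination (norm := module) ed' - h3
  have ef' : s f = 3 • s c := by linear_combination (norm := module) h4 + ee' - ea'
  -- In terms of `b` and `c`, `h6` becomes `4b + 2c = 3c`.
  have ec : s c = 4 • s b := by
    rw [ea', ed', ee', ef'] at h6
    linear_combination (norm := module) -h6
  have ea : s a = -(3 • s b) := by linear_combination (norm := module) ea' - ec
  have ed : s d = 5 • s b := by linear_combination (norm := module) ed' + ec
  have ee : s e = 9 • s b := by linear_combination (norm := module) ee' + (2 : ℤ) • ec
  have ef : s f = 12 • s b := by linear_combination (norm := module) ef' + (3 : ℤ) • ec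
  refine ⟨s b, 0, 0, Or.inr (Or.inr (Or.inr (Or.inl ⟨by rw [hS, ea, ec, ed, ee, ef],
    addOrderOf_eq_twenty ?_ ?_ ?_⟩)))⟩
  · exact ec ▸ h.ne_zero hc
  · rw [ec, ed] at hne
    intro h0
    apply hne
    linear_combination (norm := module) h0
  · rw [ee, ef] at h5
    linear_combination (norm := module) h5

theorem hasForm_of_formBicyclic (h : IsEnumeration s S) {Y : ℕ} (hY : Vanish s Y)
    (hf : formBicyclic Y = true) : HasForm S := by
  simp only [formBicyclic, anyIndex_eq_true, Bool.and_eq_true, decide_eq_true_eq] at hf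
  obtain ⟨a, ha, b, hb, c, hc, h1, d, hd, h2, e, he, h3, h4, f, hf, h5, h6, hn⟩ := hf
  have hne'' := h.ne_zero hf
  -- Once `2a = 2b` is known, this sum is `5a` and the next one is `5b`; the element `f = 4a + 4b`
  -- excludes `2a = 0`.
  have hne := h.list_sum_ne_zero (l := [a, b, e]) (by grind) (by simp [*]) (by simp)
  have hne' := h.list_sum_ne_zero (l := [a, b, d]) (by grind) (by simp [*]) (by simp)
  replace h1 := rel_sound hY (by grind) (by simp [*]) h1
  replace h2 := rel_sound hY (by grind) (by simp [*]) h2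
  replace h3 := rel_sound hY (by grind) (by simp [*]) h3
  replace h4 := rel_sound hY (by grind) (by simp [*]) h4
  replace h5 := rel_sound hY (by grind) (by simp [*]) h5
  replace h6 := rel_sound hY (by grind) (by simp [*]) h6
  simp only [List.map_cons, List.map_nil, List.sum_cons, List.sum_nil, add_zero]
    at h1 h2 h3 h4 h5 h6 hne hne'
  have hS := h.eq_of_nodup hn (by simp [*])
  have ec : s c = s a + s b := h1.symm
  have ed : s d = s a + 2 • s b := by linear_combination (norm := module) ec - h2
  have ee : s e = 2 • s a + s b := by linear_combination (norm := module) ec - h3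
  have ef : s f = 4 • s a + 4 • s b := by linear_combination (norm := module) ec + ed + ee - h5
  have e2 : 2 • s a = 2 • s b := by
    rw [ed, ee] at h4
    linear_combination (norm := module) h4
  have e10 : 10 • s a = 0 := by
    rw [ed, ef] at h6
    linear_combination (norm := module) h6 + (3 : ℤ) • e2
  have n2 : 2 • s a ≠ 0 := fun h0 => hne'' (by
    linear_combination (norm := module) ef - (2 : ℤ) • e2 + (4 : ℤ) • h0)
  refine ⟨s a, s b, 0, Or.inr (Or.inr (Or.inr (Or.inr ⟨by rw [hS, ec, ed, ee, ef], e2,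
    addOrderOf_eq_ten n2 (fun h0 => hne ?_) e10,
    addOrderOf_eq_ten (e2 ▸ n2) (fun h0 => hne' ?_) ?_⟩)))⟩
  · linear_combination (norm := module) ee - e2 + h0
  · linear_combination (norm := module) ed + e2 + h0
  · linear_combination (norm := module) e10 - (5 : ℤ) • e2

theorem hasForm_of_form (h : IsEnumeration s S) {Y : ℕ} (hY : Vanish s Y)
    (hf : form Y = true) : HasForm S := by
  simp only [form, Bool.or_eq_true] at hf
  rcases hf with hf | hf | hf | hf
  · exact h.hasForm_of_formTorsion hY hf
  · exact h.hasForm_of_formCyclic hY hf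
  · exact h.hasForm_of_formCyclic' hY hf
  · exact h.hasForm_of_formBicyclic hY hf

end IsEnumeration

end Forms

/-! ### The runs of the search -/

theorem searchFrom_triples : searchFrom [] (bits (excluded ++ triples)) = true := by
  decide +kernel

theorem searchFrom_branches : searchFrom [475]
    (bits (excluded ++ branches.flatMap fun d => [7812 - d, 7812 + d])) = true := by
  decide +kernel

theorem searchBranch_of_lt_one : [0].all searchBranch = true := by decide +kernel

theorem searchBranch_of_lt_two : [1].all searchBranch = true := by decide +kernel

theorem searchBranch_of_lt_five : [2, 3, 4].all searchBranch = true := by decide +kernel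

theorem searchBranch_of_lt_eight : [5, 6, 7].all searchBranch = true := by decide +kernel

theorem searchBranch_of_lt_eleven : [8, 9, 10].all searchBranch = true := by decide +kernel

theorem searchBranch_of_lt_fifteen : [11, 12, 13, 14].all searchBranch = true := by
  decide +kernel

theorem searchBranch_of_lt_twentyfive :
    [15, 16, 17, 18, 19, 20, 21, 22, 23, 24].all searchBranch = true := by
  decide +kernel

theorem searchBranch_eq_true {i : ℕ} (hi : i < 25) : searchBranch i = true := by
  have h : i ∈ [0] ∨ i ∈ [1] ∨ i ∈ [2, 3, 4] ∨ i ∈ [5, 6, 7] ∨ i ∈ [8, 9, 10] ∨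
      i ∈ [11, 12, 13, 14] ∨ i ∈ [15, 16, 17, 18, 19, 20, 21, 22, 23, 24] := by
    simp only [List.mem_cons, List.not_mem_nil, or_false]
    omega
  rcases h with h | h | h | h | h | h | h
  · exact List.all_eq_true.1 searchBranch_of_lt_one i h
  · exact List.all_eq_true.1 searchBranch_of_lt_two i h
  · exact List.all_eq_true.1 searchBranch_of_lt_five i h
  · exact List.all_eq_true.1 searchBranch_of_lt_eight i h
  · exact List.all_eq_true.1 searchBranch_of_lt_eleven i h
  · exact List.all_eq_true.1 searchBranch_of_lt_fifteen i h
  · exact List.all_eq_true.1 searchBranch_of_lt_twentyfive i h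

/-! ### The two directions of the classification -/

section Classification

variable {G : Type*} [AddCommGroup G]

theorem eval_relation_eq_zero {s : ℕ → G} {p q : List ℕ} (hn : (p ++ q).Nodup)
    (hl : ∀ i ∈ p ++ q, i < 6) (h : (p.map s).sum = (q.map s).sum) :
    dist (weight p) (weight q) ≤ 7812 ∧ eval s 6 (7812 - dist (weight p) (weight q)) = 0 := by
  obtain ⟨hp, hq, -⟩ := List.nodup_append.1 hn
  have hp' := fun i hi => hl i (List.mem_append_left q hi)
  have hq' := fun i hi => hl i (List.mem_append_right p hi)
  have hwp := weight_le hp hp'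
  have hwq := weight_le hq hq'
  have e : dist (weight p) (weight q) = (weight p - weight q) + (weight q - weight p) := rfl
  rw [e]
  refine ⟨by omega, ?_⟩
  rcases le_total (weight p) (weight q) with hle | hle
  · rw [eval_of_weight s hp hq hp' hq' (by omega), h, sub_self]
  · rw [eval_of_weight s hq hp hq' hp' (by omega), h, sub_self]

variable [DecidableEq G]

/-- The set `R` collects the values at the greedily chosen representatives; a point is discarded
only when its difference from a representative vanishes. -/
theorem cover_sound {s : ℕ → G} {Y : ℕ} (hY : Vanish s Y) {l : List ℕ}
    (hl : ∀ p ∈ l, p ∈ points 6) {f C : ℕ} (h : cover Y l f C = true) :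
    ∃ R : Finset G, R.card ≤ f ∧ ∀ p ∈ points 6, C.testBit p = true → eval s 6 (7812 + p) ∈ R := by
  induction l generalizing f C with
  | nil =>
    have hC : C = 0 := Nat.eq_of_beq_eq_true h
    exact ⟨∅, by simp, fun p _ hp => by simp [hC] at hp⟩
  | cons q l ih =>
    have hl' : ∀ p ∈ l, p ∈ points 6 := fun p hp => hl p (List.mem_cons_of_mem _ hp)
    have hq := hl q List.mem_cons_self
    have e : cover Y (q :: l) f C = cond (bit C q)
      (cond (Nat.beq f 0) false (forceSet (Nat.xor C (Nat.land C (around Y q))) fun C =>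
        force (Nat.pred f) fun f => cover Y l f C)) (cover Y l f C) := rfl
    rw [e, forceSet_eq, force_eq] at h
    cases hC : bit C q with
    | false => rw [hC] at h; exact ih hl' h
    | true =>
      cases f with
      | zero => rw [hC] at h; exact absurd h Bool.false_ne_true
      | succ f =>
        rw [hC] at h
        obtain ⟨R, hR, h'⟩ := ih hl' h
        rw [Nat.pred_succ] at hR
        refine ⟨insert (eval s 6 (7812 + q)) R, (Finset.card_insert_le _ _).trans (by omega),
          fun p hp hpC => ?_⟩
        rw [Finset.mem_insert]
        by_cases ha : (around Y q).testBit p = true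
        · left
          have hle := le_of_mem_points hq
          have := hY _ (testBit_around ha)
          rwa [eval_sub_points s hp hq (by omega), sub_eq_zero] at this
        · right
          refine h' p hp ?_
          have : (C ^^^ (C &&& around Y q)).testBit p = true := by
            rw [Nat.testBit_xor, Nat.testBit_and, hpC]
            simpa using ha
          exact this

theorem IsEnumeration.card_of_certificate {s : ℕ → G} {S : Finset G} (h : IsEnumeration s S)
    {R : List (List ℕ × List ℕ)}
    (hR : ∀ r ∈ R, (r.1 ++ r.2).Nodup ∧ ∀ i ∈ r.1 ++ r.2, i < 6)
    (hs : ∀ r ∈ R, (r.1.map s).sum = (r.2.map s).sum)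
    (hc : certificate R = true) : (subsetSums S).card = 19 := by
  rw [certificate, forceSet_eq, forceList_eq, forceList_eq, forceSet_eq, forceSet_eq,
    Bool.and_eq_true] at hc
  obtain ⟨h1, h2⟩ := hc
  have hg : ∀ r ∈ (R.map fun r => dist (weight r.1) (weight r.2)).map
      fun d => (d, mask 6 (7812 - d)), IsPeriod s r := fun r hr => by
    obtain ⟨d, hd, rfl⟩ := List.mem_map.1 hr
    obtain ⟨r, hr', rfl⟩ := List.mem_map.1 hd
    obtain ⟨hle, h0⟩ := eval_relation_eq_zero (hR r hr').1 (hR r hr').2 (hs r hr')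
    exact ⟨hle, rfl, h0⟩
  have hY : Vanish s (bits [7812]) := fun n hn => by
    rw [testBit_bits, List.mem_singleton] at hn
    rw [hn, ← center_six, eval_center]
  have hN := ((h.nonVanish_excluded.saturate hg).saturate hg).saturate hg
  replace hY := ((hY.saturate hg).saturate hg).saturate hg
  have hL : ∀ p ∈ (points 6).reverse, p ∈ points 6 := fun p hp => List.mem_reverse.1 hp
  have hle : (sums s).card ≤ 20 := by
    obtain ⟨T, hT, h'⟩ := cover_sound hY hL h2
    refine (Finset.card_le_card fun x hx => ?_).trans hT
    obtain ⟨p, hp, rfl⟩ := mem_sums_iff.1 hx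
    exact h' p hp ((testBit_bits _ _).2 hp)
  have hge : 20 ≤ (sums s).card := by
    -- The continuation is constantly `false`, so success means that 20 points were found.
    rcases clique_sound hN hL h1 with ⟨M, Q, hf⟩ | ⟨T, hT, h3, h4⟩
    · exact absurd hf Bool.false_ne_true
    · exact hT ▸ le_card_sums (fun p hp => (h3 p hp).1) h4
  have := h.card_sums
  omega

/-- The function with given values on `{0, …, 5}`. -/
def values (a b c d e f : G) (i : ℕ) : G := [a, b, c, d, e, f].getD i 0

theorem image_values (a b c d e f : G) :
    (Finset.range 6).image (values a b c d e f) = {a, b, c, d, e, f} := by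
  have h : Finset.range 6 = {0, 1, 2, 3, 4, 5} := rfl
  rw [h]
  simp [Finset.image_insert, values]

theorem isEnumeration_values {a b c d e f : G} {S : Finset G} (hS : S = {a, b, c, d, e, f})
    (h0 : IsZeroSumFree S) (hcard : S.card = 6) : IsEnumeration (values a b c d e f) S := by
  have hi := (image_values a b c d e f).trans hS.symm
  exact ⟨Finset.card_image_iff.1 (by rw [hi, hcard, Finset.card_range]), hi, h0⟩

/-- The lists `R` are the relations tested by the `form` predicates, with indices referring to the
order in which the form lists its elements. Form (i) splits because a multiple of an element of
order 2 is `0` or that element. -/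
theorem card_subsetSums_of_hasForm {S : Finset G} (h0 : IsZeroSumFree S) (hcard : S.card = 6)
    (h : HasForm S) : (subsetSums S).card = 19 := by
  obtain ⟨x₁, x₂, x₃, ⟨hS, ho, hm⟩ | ⟨hS, ho⟩ | ⟨hS, ho⟩ | ⟨hS, ho⟩ | ⟨hS, h2, ho, -⟩⟩ := h
  · have h1 : 2 • x₁ = 0 := ho ▸ addOrderOf_nsmul_eq_zero x₁
    have hx : 2 • x₂ = 0 ∨ 2 • x₂ = x₁ := by
      obtain ⟨n, hn⟩ := AddSubgroup.mem_zmultiples_iff.1 hm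
      rw [← hn]
      rcases Int.even_or_odd' n with ⟨m, rfl | rfl⟩
      · left; linear_combination (norm := module) m • h1
      · right; linear_combination (norm := module) m • h1
    rcases hx with hx | hx
    · refine (isEnumeration_values hS h0 hcard).card_of_certificate (R := [([0, 2], [3]), ([0, 3], [2]), ([1, 2], [4]), ([1, 4], [2]), ([0, 4], [5])])
        (by decide) ?_ (by decide +kernel)
      simp only [List.forall_mem_cons, List.map_cons, List.map_nil, List.sum_cons, List.sum_nil,
        values, List.getD_cons_zero, List.getD_cons_succ]
      refine ⟨?_, ?_, ?_, ?_, ?_, by simp⟩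
      · module
      · linear_combination (norm := module) h1
      · module
      · linear_combination (norm := module) hx
      · module
    · refine (isEnumeration_values hS h0 hcard).card_of_certificate (R := [([0, 2], [3]), ([0, 3], [2]), ([1, 2], [4]), ([1, 4], [3]), ([0, 4], [5])])
        (by decide) ?_ (by decide +kernel)
      simp only [List.forall_mem_cons, List.map_cons, List.map_nil, List.sum_cons, List.sum_nil,
        values, List.getD_cons_zero, List.getD_cons_succ]
      refine ⟨?_, ?_, ?_, ?_, ?_, by simp⟩
      · module
      · linear_combination (norm := module) h1
      · module
      · linear_combination (norm := module) hx
      · module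
  · have h1 : 2 • x₁ = 0 := ho ▸ addOrderOf_nsmul_eq_zero x₁
    refine (isEnumeration_values hS h0 hcard).card_of_certificate (R := [([0, 1], [4]), ([0, 4], [1]), ([1, 4], [5]), ([0, 5], [2]), ([2, 1], [3])])
      (by decide) ?_ (by decide +kernel)
    simp only [List.forall_mem_cons, List.map_cons, List.map_nil, List.sum_cons, List.sum_nil,
      values, List.getD_cons_zero, List.getD_cons_succ]
    refine ⟨?_, ?_, ?_, ?_, ?_, by simp⟩
    · module
    · linear_combination (norm := module) h1
    · module
    · linear_combination (norm := module) h1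
    · module
  · have h1 : 20 • x₁ = 0 := ho ▸ addOrderOf_nsmul_eq_zero x₁
    refine (isEnumeration_values hS h0 hcard).card_of_certificate (R := [([2, 0], [1]), ([2, 1], [3]), ([3, 1], [4]), ([4, 0], [2]), ([4, 1], [5]), ([2, 3, 4, 5], [0])])
      (by decide) ?_ (by decide +kernel)
    simp only [List.forall_mem_cons, List.map_cons, List.map_nil, List.sum_cons, List.sum_nil,
      values, List.getD_cons_zero, List.getD_cons_succ]
    refine ⟨?_, ?_, ?_, ?_, ?_, ?_, by simp⟩
    · module
    · module
    · module
    · module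
    · module
    · linear_combination (norm := module) h1
  · have h1 : 20 • x₁ = 0 := ho ▸ addOrderOf_nsmul_eq_zero x₁
    refine (isEnumeration_values hS h0 hcard).card_of_certificate (R := [([0, 2], [1]), ([2, 1], [3]), ([3, 2], [4]), ([5, 0], [4]), ([5, 4], [1]), ([0, 1, 3, 4], [5])])
      (by decide) ?_ (by decide +kernel)
    simp only [List.forall_mem_cons, List.map_cons, List.map_nil, List.sum_cons, List.sum_nil,
      values, List.getD_cons_zero, List.getD_cons_succ]
    refine ⟨?_, ?_, ?_, ?_, ?_, ?_, by simp⟩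
    · module
    · module
    · module
    · module
    · linear_combination (norm := module) h1
    · module
  · have h1 : 10 • x₁ = 0 := ho ▸ addOrderOf_nsmul_eq_zero x₁
    refine (isEnumeration_values hS h0 hcard).card_of_certificate (R := [([0, 1], [2]), ([1, 2], [3]), ([0, 2], [4]), ([0, 4], [1, 3]), ([2, 3, 4], [5]), ([5, 3], [0])])
      (by decide) ?_ (by decide +kernel)
    simp only [List.forall_mem_cons, List.map_cons, List.map_nil, List.sum_cons, List.sum_nil,
      values, List.getD_cons_zero, List.getD_cons_succ]
    refine ⟨?_, ?_, ?_, ?_, ?_, ?_, by simp⟩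
    · module
    · module
    · module
    · linear_combination (norm := module) h2
    · module
    · linear_combination (norm := module) h1 - (3 : ℤ) • h2

theorem IsEnumeration.hasForm_of_sum {s : ℕ → G} {S : Finset G} (h : IsEnumeration s S)
    (hs : (sums s).card ≤ 20) (h4 : s 4 = s 3 + s 2) : HasForm S := by
  -- `475 = 5^4 - 5^3 - 5^2`.
  have h0 : 475 ≤ 7812 ∧ eval s 6 (7812 - 475) = 0 :=
    eval_relation_eq_zero (p := [4]) (q := [3, 2]) (by decide) (by decide) (by simpa using h4)
  have hform : ∀ Y, Vanish s Y → form Y = true → HasForm S := fun Y => h.hasForm_of_form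
  have hle : ∀ d ∈ branches, d ≤ 7812 := by decide
  have hne : ∀ l : List ℕ, l ⊆ branches → (∀ d ∈ l, eval s 6 (7812 - d) ≠ 0) →
      NonVanish s (bits (excluded ++ l.flatMap fun d => [7812 - d, 7812 + d])) := fun l hl h' =>
    nonVanish_bits_append h.nonVanish_excluded fun n hn => by
      obtain ⟨d, hd, hn⟩ := List.mem_flatMap.1 ((testBit_bits _ _).1 hn)
      simp only [List.mem_cons, List.not_mem_nil, or_false] at hn
      rcases hn with rfl | rfl
      · exact h' d hd
      · rw [eval_opposite s (hle d (hl hd))]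
        exact neg_ne_zero.2 (h' d hd)
  -- Either no branching relation holds, or there is a least index whose relation holds, and all
  -- earlier ones may be put into `N`.
  by_cases hall : ∀ i < 25, eval s 6 (7812 - branches.getD i 0) ≠ 0
  · refine searchFrom_sound hs hform (hne branches (fun _ => id) fun d hd => ?_)
      (by simpa using h0) searchFrom_branches
    obtain ⟨i, hi, rfl⟩ := List.mem_iff_getElem.1 hd
    rw [← List.getD_eq_getElem _ 0 hi]
    exact hall i hi
  · push Not at hall
    classical
    obtain ⟨hi, hi0⟩ := Nat.find_spec hall
    set i := Nat.find hall
    have hlen : i < branches.length := hi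
    refine searchFrom_sound hs hform (hne (branches.take i) (List.take_subset _ _) fun d hd => ?_)
      (fun d hd => ?_) (searchBranch_eq_true hi)
    · obtain ⟨j, hj, rfl⟩ := List.mem_iff_getElem.1 hd
      rw [List.length_take] at hj
      have hji : j < i := by omega
      rw [List.getElem_take, ← List.getD_eq_getElem _ 0 (by omega)]
      exact fun h' => Nat.find_min hall hji ⟨by omega, h'⟩
    · rcases List.mem_cons.1 hd with rfl | hd
      · refine ⟨hle _ ?_, hi0⟩
        rw [List.getD_eq_getElem _ 0 hlen]
        exact List.getElem_mem hlen
      · rw [List.mem_singleton.1 hd]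
        exact h0

theorem hasForm_of_card_subsetSums {S : Finset G} (h0 : IsZeroSumFree S) (hcard : S.card = 6)
    (h : (subsetSums S).card = 19) : HasForm S := by
  by_cases ht : ∀ x ∈ S, ∀ y ∈ S, ∀ z ∈ S, y ≠ z → x ≠ y + z
  · obtain ⟨a, b, c, d, e, f, hS⟩ : ∃ a b c d e f, S = {a, b, c, d, e, f} := by
      obtain ⟨l, hl⟩ : ∃ l : List G, l = S.toList := ⟨_, rfl⟩
      have hlen : l.length = 6 := by rw [hl, Finset.length_toList, hcard]
      match l, hlen with
      | [a, b, c, d, e, f], _ =>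
        refine ⟨a, b, c, d, e, f, ?_⟩
        rw [← Finset.toList_toFinset S, ← hl]
        simp
    have hE := isEnumeration_values hS h0 hcard
    exact searchFrom_sound (by rw [hE.card_sums, h]) (fun Y => hE.hasForm_of_form)
      (nonVanish_bits_append hE.nonVanish_excluded (hE.nonVanish_triples ht)) (by simp)
      searchFrom_triples
  · push Not at ht
    obtain ⟨x, hx, y, hy, z, hz, hyz, hxyz⟩ := ht
    have hne : ∀ w ∈ S, w ≠ 0 := fun w hw hw0 => h0 (by
      simpa [hw0] using sum_mem_subsetSums (Finset.singleton_subset_iff.2 hw)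
        (Finset.singleton_nonempty w))
    have hxy : x ≠ y := fun he => hne z hz (by simpa [he] using hxyz)
    have hxz : x ≠ z := fun he => hne y hy (by simpa [he] using hxyz)
    have hsub : {z, y, x} ⊆ S := by
      simp [Finset.insert_subset_iff, hx, hy, hz]
    have h3 : ({z, y, x} : Finset G).card = 3 :=
      Finset.card_eq_three.2 ⟨z, y, x, hyz.symm, hxz.symm, hxy.symm, rfl⟩
    obtain ⟨u, v, w, -, -, -, huvw⟩ := Finset.card_eq_three.1
      (show (S \ {z, y, x}).card = 3 by rw [Finset.card_sdiff_of_subset hsub, hcard, h3])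
    -- This order puts `z, y, x` at positions 2, 3, 4, so that `x = y + z` is `s 4 = s 3 + s 2`.
    have hS : S = {u, v, z, y, x, w} := by
      rw [← Finset.sdiff_union_of_subset hsub, huvw]
      ext t
      simp only [Finset.mem_union, Finset.mem_insert, Finset.mem_singleton]
      tauto
    have hE := isEnumeration_values hS h0 hcard
    exact hE.hasForm_of_sum (by rw [hE.card_sums, h]) hxyz

end Classification

end SubsetSumSearch

theorem theorem1p2 {G : Type*} [AddCommGroup G] [DecidableEq G] (S : Finset G)
    (hS : IsZeroSumFree S) (hcard : S.card = 6) :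
    (subsetSums S).card = 19 ↔
      ∃ x₁ x₂ x₃ : G,
        (S = {x₁, x₂, x₃, x₁ + x₃, x₂ + x₃, x₁ + x₂ + x₃} ∧
          addOrderOf x₁ = 2 ∧ 2 • x₂ ∈ AddSubgroup.zmultiples x₁) ∨
        (S = {x₁, x₂, 2 • x₂, 3 • x₂, x₁ + x₂, x₁ + 2 • x₂} ∧
          addOrderOf x₁ = 2) ∨
        (S = {-(2 • x₁), x₁, 3 • x₁, 4 • x₁, 5 • x₁, 6 • x₁} ∧
          addOrderOf x₁ = 20) ∨
        (S = {-(3 • x₁), x₁, 4 • x₁, 5 • x₁, 9 • x₁, 12 • x₁} ∧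
          addOrderOf x₁ = 20) ∨
        (S = {x₁, x₂, x₁ + x₂, x₁ + 2 • x₂, 2 • x₁ + x₂, 4 • x₁ + 4 • x₂} ∧
          2 • x₁ = 2 • x₂ ∧ addOrderOf x₁ = 10 ∧ addOrderOf x₂ = 10) := by
  exact ⟨SubsetSumSearch.hasForm_of_card_subsetSums hS hcard,
    SubsetSumSearch.card_subsetSums_of_hasForm hS hcard⟩
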